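/- For a particle configuration $\eta=(\eta_n)_{n\in\mathbb Z}\in\{0,1\}^{\mathbb Z}$ let $S=(S_n)_{n\in\mathbb Z}$ be its path encoding, given by $S_0=0$ and $S_n=S_{n-1}+1-2\eta_n$ for all $n\in\mathbb Z$. Write $\mathcal S^0=\{S:\mathbb Z\to\mathbb Z:\ S_0=0,\ |S_n-S_{n-1}|=1\ \forall n\in\mathbb Z\}$, and put $M_n=\sup_{m\le n}S_m$, $I_n=\inf_{m\ge n}S_m$. For $S\in\mathcal S^0$, say that $TS$ is well-defined if $M_0<\infty$, and then $(TS)_n=2M_n-S_n-2M_0$; say that $T^{-1}S$ is well-defined if $I_0>-\infty$, and then $(T^{-1}S)_n=2I_n-S_n-2I_0$. If $\eta$ has path encoding $S$ and $TS$ is well-defined, then $T\eta$ is the configuration $(T\eta)_n=\mathbf 1_{\{(TS)_n=(TS)_{n-1}-1\}}$ (one step of the box-ball system). Let $$\mathcal S^{rev}=\{S\in\mathcal S^0:\ TS,\ T^{-1}S,\ T^{-1}TS,\ TT^{-1}S\text{ well-defined},\ T^{-1}TS=S,\ TT^{-1}S=S\}.$$ Let $\mathcal S^{+}_{sub\text{-}critical}$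 (resp. $\mathcal S^{-}_{sub\text{-}critical}$) be the set of $S\in\mathcal S^0$ for which there is a strictly increasing $F:\mathbb Z\to\mathbb R$ with $F(n)\to\infty$ as $n\to\infty$ (resp. $F(n)\to-\infty$ as $n\to-\infty$) and $S_n/F(n)\to1$ as $n\to\infty$ (resp. as $n\to-\infty$). Let $\mathcal S^{\pm}_{critical}$ be the set of $S\in\mathcal S^0$ for which there is an integer $K\ge1$ with $$\sup_{n\in\mathbb Z}(M_n-I_n)=\limsup_{n\to\pm\infty}S_n-\liminf_{n\to\pm\infty}S_n=K.$$ Put $\mathcal S_{sub\text{-}critical}=\mathcal S^-_{sub\text{-}critical}\cap\mathcal S^+_{sub\text{-}critical}$ and $\mathcal S_{critical}=\mathcal S^-_{critical}\cap\mathcal S^+_{critical}$. **Theorem.** Let $\eta$ be a random particle configuration, defined on a probability space with probability measure $\mathbf P$, whose path encoding $S$ satisfies $S\in\mathcal S^{rev}$ $\mathbf P$-a.s., and suppose that $T\eta$ and $\eta$ have the same distribution. Then $$S\in\mathcal S_{sub\text{-}critical}\cup\mathcal S_{critical}\qquad\mathbf P\text{-a.s.}$$ Moreover, there exists a constant $\rho\in[0,\tfrac12]$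 such that $\mathbf P(\eta_n=1)=\rho$ for all $n\in\mathbb Z$, and $\rho=\tfrac12$ if and only if $S\in\mathcal S_{critical}$ $\mathbf P$-a.s. -/

import Mathlib

namespace BoxBall

/-- Two-sided particle configurations: `η n = 1` means that there is a particle at site `n`.
Carries the product `σ`-algebra. -/
abbrev Config : Type := ℤ → Fin 2

/-- The path encoding of `η`: the path with `S 0 = 0` and increments
`S n - S (n - 1) = 1 - 2 η n` for all integers `n`
(see `pathEncoding_zero` and `pathEncoding_step`). -/
noncomputable def pathEncoding (η : Config) (n : ℤ) : ℤ :=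
  ∑ m ∈ Finset.Ioc 0 n, (1 - 2 * ((η m : ℕ) : ℤ)) -
    ∑ m ∈ Finset.Ioc n 0, (1 - 2 * ((η m : ℕ) : ℤ))

theorem pathEncoding_zero (η : Config) : pathEncoding η 0 = 0 := by
  simp [pathEncoding]

theorem pathEncoding_step (η : Config) (n : ℤ) :
    pathEncoding η n = pathEncoding η (n - 1) + 1 - 2 * ((η n : ℕ) : ℤ) := by
  unfold pathEncoding
  rcases le_or_gt 1 n with h | h
  · have h1 : Finset.Ioc 0 n = insert n (Finset.Ioc 0 (n - 1)) := by
      ext m; simp only [Finset.mem_Ioc, Finset.mem_insert]; omega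
    have h2 : Finset.Ioc n 0 = ∅ := Finset.Ioc_eq_empty (by omega)
    have h3 : Finset.Ioc (n - 1) 0 = ∅ := Finset.Ioc_eq_empty (by omega)
    rw [h1, h2, h3, Finset.sum_insert (by simp)]
    simp only [Finset.sum_empty]; ring
  · have h1 : Finset.Ioc (n - 1) 0 = insert n (Finset.Ioc n 0) := by
      ext m; simp only [Finset.mem_Ioc, Finset.mem_insert]; omega
    have h2 : Finset.Ioc 0 n = ∅ := Finset.Ioc_eq_empty (by omega)
    have h3 : Finset.Ioc 0 (n - 1) = ∅ := Finset.Ioc_eq_empty (by omega)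
    rw [h1, h2, h3, Finset.sum_insert (by simp)]
    simp only [Finset.sum_empty]; ring

/-- `𝒮⁰`: two-sided nearest-neighbour integer paths started from `0`. -/
def Paths : Set (ℤ → ℤ) := {S | S 0 = 0 ∧ ∀ n, |S n - S (n - 1)| = 1}

/-- The past maximum `M n = sup_{m ≤ n} S m`, an integer. It is meaningful only if `S` is
bounded above near `-∞`, i.e. on `DomT`. -/
noncomputable def pastMax (S : ℤ → ℤ) (n : ℤ) : ℤ := sSup (S '' Set.Iic n)

/-- The future minimum `I n = inf_{m ≥ n} S m`, an integer. It is meaningful only if `S` is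
bounded below near `+∞`, i.e. on `DomTInv`. -/
noncomputable def futureMin (S : ℤ → ℤ) (n : ℤ) : ℤ := sInf (S '' Set.Ici n)

/-- Paths for which `T S` is well-defined: `M 0 < ∞`. -/
def DomT : Set (ℤ → ℤ) := {S | S ∈ Paths ∧ BddAbove (S '' Set.Iic 0)}

/-- Paths for which `T⁻¹ S` is well-defined: `I 0 > -∞`. -/
def DomTInv : Set (ℤ → ℤ) := {S | S ∈ Paths ∧ BddBelow (S '' Set.Ici 0)}

/-- One step of the dynamics on paths, `(T S) n = 2 M n - S n - 2 M 0` (used on `DomT`). -/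
noncomputable def T (S : ℤ → ℤ) (n : ℤ) : ℤ := 2 * pastMax S n - S n - 2 * pastMax S 0

/-- The backwards dynamics on paths, `(T⁻¹ S) n = 2 I n - S n - 2 I 0` (used on `DomTInv`). -/
noncomputable def TInv (S : ℤ → ℤ) (n : ℤ) : ℤ := 2 * futureMin S n - S n - 2 * futureMin S 0

/-- `𝒮^rev`: paths such that `T S`, `T⁻¹ S`, `T⁻¹ T S`, `T T⁻¹ S` are all well-defined and
`T⁻¹ T S = S = T T⁻¹ S`. -/
def SRev : Set (ℤ → ℤ) :=
  {S | S ∈ Paths ∧ S ∈ DomT ∧ S ∈ DomTInv ∧ T S ∈ DomTInv ∧ TInv S ∈ DomT ∧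
    TInv (T S) = S ∧ T (TInv S) = S}

/-- One step of the box-ball system on configurations: `T η` has a particle at `n` iff the
path `T S` steps down at `n`, where `S` is the path encoding of `η`. -/
noncomputable def configT (η : Config) (n : ℤ) : Fin 2 :=
  if T (pathEncoding η) n = T (pathEncoding η) (n - 1) - 1 then 1 else 0

/-- `M n` as an extended real number; agrees with `pastMax` whenever the supremum is finite,
see `coe_pastMax`. -/
noncomputable def extPastMax (S : ℤ → ℤ) (n : ℤ) : EReal := ⨆ m ∈ Set.Iic n, ((S m : ℝ) : EReal)

/-- `I n` as an extended real number; agrees with `futureMin` whenever the infimum is finite,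
see `coe_futureMin`. -/
noncomputable def extFutureMin (S : ℤ → ℤ) (n : ℤ) : EReal :=
  ⨅ m ∈ Set.Ici n, ((S m : ℝ) : EReal)

theorem coe_pastMax {S : ℤ → ℤ} {n : ℤ} (h : BddAbove (S '' Set.Iic n)) :
    ((pastMax S n : ℝ) : EReal) = extPastMax S n := by
  have hne : (S '' Set.Iic n).Nonempty := ⟨S n, n, by simp, rfl⟩
  obtain ⟨k, hk, hk'⟩ := Int.csSup_mem hne h
  apply le_antisymm
  · unfold pastMax extPastMax
    rw [← hk']
    exact le_iSup₂ (f := fun m (_ : m ∈ Set.Iic n) => ((S m : ℝ) : EReal)) k hk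
  · refine iSup₂_le fun m hm => ?_
    have : S m ≤ pastMax S n := le_csSup h ⟨m, hm, rfl⟩
    exact_mod_cast this

theorem coe_futureMin {S : ℤ → ℤ} {n : ℤ} (h : BddBelow (S '' Set.Ici n)) :
    ((futureMin S n : ℝ) : EReal) = extFutureMin S n := by
  have hne : (S '' Set.Ici n).Nonempty := ⟨S n, n, by simp, rfl⟩
  obtain ⟨k, hk, hk'⟩ := Int.csInf_mem hne h
  apply le_antisymm
  · refine le_iInf₂ fun m hm => ?_
    have : futureMin S n ≤ S m := csInf_le h ⟨m, hm, rfl⟩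
    exact_mod_cast this
  · unfold futureMin extFutureMin
    rw [← hk']
    exact iInf₂_le (f := fun m (_ : m ∈ Set.Ici n) => ((S m : ℝ) : EReal)) k hk

open Filter Topology in
/-- `𝒮⁺_sub-critical`: `S n / F n → 1` as `n → ∞` for some strictly increasing `F : ℤ → ℝ`
with `F n → ∞`. -/
def SubCriticalPlus : Set (ℤ → ℤ) :=
  {S | S ∈ Paths ∧ ∃ F : ℤ → ℝ, StrictMono F ∧ Tendsto F atTop atTop ∧
    Tendsto (fun n => (S n : ℝ) / F n) atTop (𝓝 1)}

open Filter Topology in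
/-- `𝒮⁻_sub-critical`: `S n / F n → 1` as `n → -∞` for some strictly increasing `F : ℤ → ℝ`
with `F n → -∞` as `n → -∞`. -/
def SubCriticalMinus : Set (ℤ → ℤ) :=
  {S | S ∈ Paths ∧ ∃ F : ℤ → ℝ, StrictMono F ∧ Tendsto F atBot atBot ∧
    Tendsto (fun n => (S n : ℝ) / F n) atBot (𝓝 1)}

open Filter in
/-- `𝒮⁺_critical`: `sup_n (M n - I n) = limsup_{n → ∞} S n - liminf_{n → ∞} S n = K` for some
positive integer `K`. Here `M n > -∞` and `I n < ∞`, and an upper and a lower limit that are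
equal and infinite have difference `⊥ ≠ K`. -/
def CriticalPlus : Set (ℤ → ℤ) :=
  {S | S ∈ Paths ∧ ∃ K : ℕ, 0 < K ∧
    (⨆ n, (extPastMax S n - extFutureMin S n)) = ((K : ℝ) : EReal) ∧
    limsup (fun n => ((S n : ℝ) : EReal)) atTop - liminf (fun n => ((S n : ℝ) : EReal)) atTop
      = ((K : ℝ) : EReal)}

open Filter in
/-- `𝒮⁻_critical`: `sup_n (M n - I n) = limsup_{n → -∞} S n - liminf_{n → -∞} S n = K` for some
positive integer `K`. -/
def CriticalMinus : Set (ℤ → ℤ) :=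
  {S | S ∈ Paths ∧ ∃ K : ℕ, 0 < K ∧
    (⨆ n, (extPastMax S n - extFutureMin S n)) = ((K : ℝ) : EReal) ∧
    limsup (fun n => ((S n : ℝ) : EReal)) atBot - liminf (fun n => ((S n : ℝ) : EReal)) atBot
      = ((K : ℝ) : EReal)}

/-- `𝒮_sub-critical`. -/
def SubCritical : Set (ℤ → ℤ) := SubCriticalMinus ∩ SubCriticalPlus

/-- `𝒮_critical`. -/
def Critical : Set (ℤ → ℤ) := CriticalMinus ∩ CriticalPlus

end BoxBall

/-! Write `M`, `I` for past maximum and future minimum, `W = M - S` for the load. Reversibility says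
that the future minimum of `T S` is `M` up to a constant (`futureMin_T`). Two consequences drive the
proof.

Dichotomy. A load of `S` reappears in `T S` strictly further right (`exists_lt_load_T`), so under an
invariant law a bound on the loads near `+∞` holds everywhere (`ae_load_le`). If `M` is constant
from `n` on, this forces `I` to be constant from `n - 1` on; but by `futureMin_T` and invariance the
two events "constant from `n` on" have the same probability. An increasing family of events whose
measures do not increase is a.s. constant, so `M` and `I` are constant on all of `ℤ` and the path is
critical. Otherwise `M → ∞`, and pulling a load back through many steps of `T⁻¹` shows `W = o(M)`
(`load_alternative`), so `S ~ M`. Space reversal treats `-∞`.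

Density. A site holds a particle of `η`, or one of `T η`, or is a record of `S`, exclusively. Hence
`1 - 2ρ` is the probability of a record, which vanishes exactly when `M` is a.s. constant. -/

namespace BoxBall

open MeasureTheory Filter Topology Set

section Deterministic

variable {S : ℤ → ℤ} {m n : ℤ}

/-! ### Past maxima and future minima -/

theorem bddAbove_image_Iic (h : S ∈ DomT) (n : ℤ) : BddAbove (S '' Iic n) := by
  refine (h.2.union ((Set.finite_Icc 0 n).image S).bddAbove).mono ?_
  rw [← Set.image_union]
  refine Set.image_mono fun m hm => ?_
  simp only [mem_Iic, mem_union, mem_Icc] at hm ⊢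
  omega

theorem le_pastMax (h : S ∈ DomT) (hmn : m ≤ n) : S m ≤ pastMax S n :=
  le_csSup (bddAbove_image_Iic h n) ⟨m, hmn, rfl⟩

theorem exists_eq_pastMax (h : S ∈ DomT) (n : ℤ) : ∃ m ≤ n, S m = pastMax S n :=
  Int.csSup_mem (s := S '' Iic n) ⟨S n, n, self_mem_Iic, rfl⟩ (bddAbove_image_Iic h n)

theorem pastMax_mono (h : S ∈ DomT) : Monotone (pastMax S) := fun a b hab => by
  obtain ⟨m, hm, e⟩ := exists_eq_pastMax h a
  exact e ▸ le_pastMax h (hm.trans hab)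

theorem pastMax_eq_max (h : S ∈ DomT) (n : ℤ) :
    pastMax S n = max (pastMax S (n - 1)) (S n) := by
  apply le_antisymm
  · obtain ⟨m, hm, e⟩ := exists_eq_pastMax h n
    rcases hm.eq_or_lt with rfl | hlt
    · exact e ▸ le_max_right _ _
    · exact e ▸ (le_pastMax h (by omega)).trans (le_max_left _ _)
  · exact max_le (pastMax_mono h (by omega)) (le_pastMax h le_rfl)

theorem bddBelow_image_Ici (h : S ∈ DomTInv) (n : ℤ) : BddBelow (S '' Ici n) := by
  refine (h.2.union ((Set.finite_Icc n 0).image S).bddBelow).mono ?_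
  rw [← Set.image_union]
  refine Set.image_mono fun m hm => ?_
  simp only [mem_Ici, mem_union, mem_Icc] at hm ⊢
  omega

theorem futureMin_le (h : S ∈ DomTInv) (hmn : n ≤ m) : futureMin S n ≤ S m :=
  csInf_le (bddBelow_image_Ici h n) ⟨m, hmn, rfl⟩

theorem exists_eq_futureMin (h : S ∈ DomTInv) (n : ℤ) : ∃ m, n ≤ m ∧ S m = futureMin S n :=
  Int.csInf_mem (s := S '' Ici n) ⟨S n, n, self_mem_Ici, rfl⟩ (bddBelow_image_Ici h n)

theorem futureMin_mono (h : S ∈ DomTInv) : Monotone (futureMin S) := fun a b hab => by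
  obtain ⟨m, hm, e⟩ := exists_eq_futureMin h b
  exact e ▸ futureMin_le h (hab.trans hm)

theorem Paths.step (h : S ∈ Paths) (n : ℤ) : S n = S (n - 1) + 1 ∨ S n = S (n - 1) - 1 := by
  have := h.2 n
  rcases abs_eq (by norm_num : (0 : ℤ) ≤ 1) |>.1 this with h | h <;> omega

/-! ### Space reversal -/

/-- The path of the configuration reversed in space. -/
def reverse (S : ℤ → ℤ) (n : ℤ) : ℤ := -S (-n)

@[simp]
theorem reverse_reverse (S : ℤ → ℤ) : reverse (reverse S) = S := by
  funext n; simp [reverse]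

theorem reverse_image_Iic (S : ℤ → ℤ) (n : ℤ) : reverse S '' Iic n = -(S '' Ici (-n)) := by
  ext x
  simp only [reverse, mem_image, mem_Iic, Set.mem_neg, mem_Ici]
  constructor
  · rintro ⟨m, hm, rfl⟩; exact ⟨-m, by omega, by simp⟩
  · rintro ⟨m, hm, e⟩; exact ⟨-m, by omega, by simp [e]⟩

theorem pastMax_reverse (S : ℤ → ℤ) (n : ℤ) : pastMax (reverse S) n = -futureMin S (-n) := by
  have hne : (S '' Ici (-n)).Nonempty := ⟨_, -n, self_mem_Ici, rfl⟩
  unfold pastMax futureMin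
  rw [reverse_image_Iic]
  by_cases hb : BddBelow (S '' Ici (-n))
  · exact csSup_neg hne hb
  -- Unbounded integer sets have supremum and infimum `0`, so the identity needs no hypothesis.
  · rw [Int.csInf_of_not_bddBelow hb, Int.csSup_of_not_bddAbove (by rwa [bddAbove_neg]), neg_zero]

theorem futureMin_reverse (S : ℤ → ℤ) (n : ℤ) : futureMin (reverse S) n = -pastMax S (-n) := by
  have := pastMax_reverse (reverse S) (-n)
  rw [reverse_reverse, neg_neg] at this
  omega

theorem T_reverse (S : ℤ → ℤ) : T (reverse S) = reverse (TInv S) := by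
  funext n
  simp only [T, TInv, pastMax_reverse, reverse, neg_zero]
  ring

theorem TInv_reverse (S : ℤ → ℤ) : TInv (reverse S) = reverse (T S) := by
  funext n
  simp only [T, TInv, futureMin_reverse, reverse, neg_zero]
  ring

theorem reverse_mem_Paths (h : S ∈ Paths) : reverse S ∈ Paths := by
  refine ⟨by simp [reverse, h.1], fun n => ?_⟩
  have := Paths.step h (-n + 1)
  have e : -(n - 1) = -n + 1 := by ring
  simp only [reverse, e, add_sub_cancel_right] at this ⊢
  rcases this with h | h <;> rw [h] <;> ring_nf <;> norm_num

theorem reverse_mem_DomT (h : S ∈ DomTInv) : reverse S ∈ DomT :=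
  ⟨reverse_mem_Paths h.1, by rw [reverse_image_Iic, bddAbove_neg, neg_zero]; exact h.2⟩

theorem reverse_mem_DomTInv (h : S ∈ DomT) : reverse S ∈ DomTInv := by
  refine ⟨reverse_mem_Paths h.1, ?_⟩
  have := reverse_image_Iic (reverse S) 0
  rw [reverse_reverse, neg_zero] at this
  rw [← bddAbove_neg, ← this]
  exact h.2

theorem reverse_mem_SRev (h : S ∈ SRev) : reverse S ∈ SRev := by
  obtain ⟨h0, h1, h2, h3, h4, h5, h6⟩ := h
  refine ⟨reverse_mem_Paths h0, reverse_mem_DomT h2, reverse_mem_DomTInv h1, ?_, ?_, ?_, ?_⟩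
  · rw [T_reverse]; exact reverse_mem_DomTInv h4
  · rw [TInv_reverse]; exact reverse_mem_DomT h3
  · rw [T_reverse, TInv_reverse, h6]
  · rw [TInv_reverse, T_reverse, h5]

/-! ### Reversible paths -/

/-- `T⁻¹ T S = S` gives the identity up to an additive constant. The constant is found at a point `p
≤ 0` where `M 0` is attained, using the general bound `T S q ≥ M q - 2 M 0`. -/
theorem futureMin_T (h : S ∈ SRev) (n : ℤ) :
    futureMin (T S) n = pastMax S n - 2 * pastMax S 0 := by
  obtain ⟨-, h1, -, h3, -, h5, -⟩ := h
  have key : ∀ n, futureMin (T S) n - futureMin (T S) 0 = pastMax S n - pastMax S 0 := fun n => by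
    have := congrFun h5 n
    simp only [TInv, T] at this ⊢
    omega
  obtain ⟨p, hp, ep⟩ := exists_eq_pastMax h1 0
  have a1 := futureMin_le h3 (le_refl p)
  have a2 := le_pastMax h1 (le_refl p)
  have a3 := pastMax_mono h1 hp
  obtain ⟨q, hq, eq⟩ := exists_eq_futureMin h3 p
  have a4 := le_pastMax h1 (le_refl q)
  have a5 := pastMax_mono h1 hq
  have kn := key n
  have kp := key p
  simp only [T] at a1 eq
  omega

theorem exists_future_eq_pastMax (h : S ∈ SRev) (n : ℤ) : ∃ m, n ≤ m ∧ S m = pastMax S n := by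
  obtain ⟨m, hm, e⟩ := exists_eq_futureMin h.2.2.2.1 n
  rw [futureMin_T h] at e
  have a1 := le_pastMax h.2.1 (le_refl m)
  have a2 := pastMax_mono h.2.1 hm
  simp only [T] at e
  exact ⟨m, hm, by omega⟩

theorem pastMax_TInv (h : S ∈ SRev) (n : ℤ) :
    pastMax (TInv S) n = futureMin S n - 2 * futureMin S 0 := by
  have := futureMin_T (reverse_mem_SRev h) (-n)
  simp only [T_reverse, futureMin_reverse, pastMax_reverse, neg_neg, neg_zero] at this
  omega

theorem exists_past_eq_futureMin (h : S ∈ SRev) (n : ℤ) : ∃ m ≤ n, S m = futureMin S n := by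
  obtain ⟨m, hm, e⟩ := exists_future_eq_pastMax (reverse_mem_SRev h) (-n)
  rw [pastMax_reverse, neg_neg] at e
  exact ⟨-m, by omega, by simpa [reverse] using e⟩

/-- The carrier load `M n - S n`. -/
noncomputable def load (S : ℤ → ℤ) (n : ℤ) : ℤ := pastMax S n - S n

/-- `T S` lies at height `load S n` above its future minimum at `n`, so it must drop by that much;
since the load is positive, the drop ends strictly to the right of `n`. -/
theorem exists_lt_load_T (h : S ∈ SRev) (hT : T S ∈ SRev) (n k : ℤ) (hk : 0 ≤ k)
    (hn : k < load S n) : ∃ m, n < m ∧ k < load (T S) m := by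
  obtain ⟨m, hm, e⟩ := exists_eq_futureMin h.2.2.2.1 n
  have a1 := futureMin_T h n
  have a2 := le_pastMax hT.2.1 hm
  have a3 : T S n = 2 * pastMax S n - S n - 2 * pastMax S 0 := rfl
  unfold load at *
  refine ⟨m, lt_of_le_of_ne hm ?_, by omega⟩
  rintro rfl
  omega

/-- Once `M` and `I` are both constant, loads are at most their difference. By `hW` this holds at
every site, so the path cannot lie below the limiting value of `I` from `n - 1` on. -/
theorem eventually_const_futureMin (h : S ∈ SRev) (hn : ∀ m, n ≤ m → pastMax S m = pastMax S n)
    (hW : ∀ k : ℤ, 0 ≤ k → ∀ p, (∀ m, p < m → load S m ≤ k) → ∀ m, load S m ≤ k) :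
    ∀ m, n - 1 ≤ m → futureMin S m = futureMin S (n - 1) := by
  obtain ⟨h0, h1, h2, -⟩ := h
  have hmono := futureMin_mono h2
  have hup : ∀ m, futureMin S m ≤ pastMax S n := fun m =>
    ((hmono (le_max_left m n)).trans (futureMin_le h2 le_rfl)).trans
      ((le_pastMax h1 le_rfl).trans (hn _ (le_max_right _ _)).le)
  obtain ⟨J, ⟨q, rfl⟩, hJ⟩ : ∃ J ∈ Set.range (futureMin S), ∀ m, futureMin S m ≤ J := by
    have hb : BddAbove (Set.range (futureMin S)) := ⟨_, by rintro _ ⟨m, rfl⟩; exact hup m⟩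
    exact ⟨_, Int.csSup_mem (Set.range_nonempty _) hb, fun m => le_csSup hb ⟨m, rfl⟩⟩
  have hq : ∀ m, q ≤ m → futureMin S m = futureMin S q := fun m hm =>
    le_antisymm (hJ m) (hmono hm)
  have hload : ∀ m, load S m ≤ pastMax S n - futureMin S q := by
    refine hW _ (by have := hup q; omega) (max q n) fun m hm => ?_
    have a1 := hn m (by omega)
    have a2 := futureMin_le h2 (show q ≤ m by omega)
    unfold load
    omega
  have hlt : futureMin S q < pastMax S n := by
    have s := Paths.step h0 (max q n + 1)
    rw [add_sub_cancel_right] at s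
    have a1 := futureMin_le h2 (le_max_left q n)
    have a2 := futureMin_le h2 (show q ≤ max q n + 1 by omega)
    have a3 := le_pastMax h1 (le_refl (max q n))
    have a4 := le_pastMax h1 (le_refl (max q n + 1))
    rw [hn _ (by omega)] at a3 a4
    omega
  suffices H : ∀ p, n - 1 ≤ p → futureMin S q ≤ S p by
    have : futureMin S q ≤ futureMin S (n - 1) := by
      obtain ⟨p, hp, e⟩ := exists_eq_futureMin h2 (n - 1)
      exact e ▸ H p hp
    intro m hm
    have a1 := hmono hm
    have a2 := hJ m
    omega
  intro p hp
  by_contra! hlow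
  have a1 := hload p
  unfold load at a1
  -- The extra site `n - 1` costs nothing: if `M` increases at `n`, then `S (n - 1)` is just one
  -- below `M n`, still at least the limit of `I`.
  rcases lt_or_ge p n with hpn | hpn
  · obtain rfl : p = n - 1 := by omega
    have a2 := pastMax_eq_max h1 n
    have a3 := Paths.step h0 n
    omega
  · have a2 := hn p hpn
    omega

/-- A load `w` at `n` is a descent from a maximum at `p ≤ n`. Then `T⁻¹ S` has load at least `w` at
`p`, while its past maximum there is at most `M n - w` up to a constant. Each backward step thus
costs `w`, and `k` steps give `k * w ≤ M n + C`. -/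
theorem load_alternative (k : ℕ) : ∀ S : ℤ → ℤ, (∀ j : ℕ, TInv^[j] S ∈ SRev) →
    ∃ C : ℤ, ∀ n, 0 ≤ n → load S n ≤ C ∨ k * load S n ≤ pastMax S n + C := by
  induction k with
  | zero =>
    intro S hS
    refine ⟨0, fun n hn => Or.inr ?_⟩
    have a1 := le_pastMax (hS 0).2.1 hn
    have a2 := (hS 0).1.1
    simp only [Function.iterate_zero, id_eq] at a1 a2
    push_cast
    omega
  | succ k ih =>
    intro S hS
    obtain ⟨C, hC⟩ := ih (TInv S) fun j => by
      have := hS (j + 1); rwa [Function.iterate_succ_apply] at this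
    have h : S ∈ SRev := hS 0
    refine ⟨max (pastMax S 0 - futureMin S 0) (max C (C - 2 * futureMin S 0)), fun n hn => ?_⟩
    obtain ⟨p, hp, e⟩ := exists_eq_pastMax h.2.1 n
    rcases lt_or_ge p 0 with hp0 | hp0
    · left
      have a1 := le_pastMax h.2.1 hp0.le
      have a2 := futureMin_le h.2.2.1 hn
      unfold load
      omega
    -- A maximum attained before `0` bounds the load by `M 0 - I 0`; only `p ≥ 0` calls for the
    -- induction.
    · have a1 := pastMax_TInv h p
      have a2 := futureMin_le h.2.2.1 hp
      have a3 : load (TInv S) p = S p - futureMin S p := by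
        unfold load; rw [a1]; unfold TInv; ring
      have a4 : load S n ≤ load (TInv S) p := by rw [a3]; unfold load; omega
      rcases hC p hp0 with hc | hc
      · left; omega
      · right
        have a5 : (k : ℤ) * load S n ≤ k * load (TInv S) p :=
          mul_le_mul_of_nonneg_left a4 (by positivity)
        push_cast
        rw [add_mul, one_mul]
        omega

theorem tendsto_pastMax (h : S ∈ DomT) (hn : ∀ n, ¬ ∀ m, n ≤ m → pastMax S m = pastMax S n) :
    Tendsto (pastMax S) atTop atTop := by
  refine tendsto_atTop_atTop_of_monotone (pastMax_mono h) fun b => ?_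
  by_contra! hb
  have hbd : BddAbove (Set.range (pastMax S)) := ⟨b, by rintro _ ⟨m, rfl⟩; exact (hb m).le⟩
  obtain ⟨n, e⟩ := Int.csSup_mem (Set.range_nonempty _) hbd
  exact hn n fun m hm => le_antisymm (e ▸ le_csSup hbd ⟨m, rfl⟩) (pastMax_mono h hm)

theorem mem_SubCriticalPlus (hS : ∀ j : ℕ, TInv^[j] S ∈ SRev)
    (hn : ∀ n, ¬ ∀ m, n ≤ m → pastMax S m = pastMax S n) : S ∈ SubCriticalPlus := by
  have h : S ∈ SRev := hS 0
  have hM := tendsto_pastMax h.2.1 hn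
  have hMR : Tendsto (fun n => (pastMax S n : ℝ)) atTop atTop :=
    tendsto_intCast_atTop_atTop.comp hM
  -- A bounded, strictly increasing correction turns the monotone `M` into an admissible `F`.
  set g : ℤ → ℝ := fun n => Real.arctan n with hg
  have hgb : ∀ n, |g n| ≤ 2 := fun n => by
    have := Real.arctan_lt_pi_div_two n
    have := Real.neg_pi_div_two_lt_arctan n
    have := Real.pi_lt_four
    rw [abs_le]; constructor <;> simp only [hg] <;> linarith
  have hF : Tendsto (fun n => (pastMax S n : ℝ) + g n) atTop atTop :=
    tendsto_atTop_add_right_of_le _ (-2) hMR fun n => (abs_le.1 (hgb n)).1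
  refine ⟨h.1, fun n => (pastMax S n : ℝ) + g n, ?_, hF, ?_⟩
  · intro a b hab
    have a1 : (pastMax S a : ℝ) ≤ pastMax S b := by exact_mod_cast pastMax_mono h.2.1 hab.le
    have a2 : g a < g b := Real.arctan_strictMono (by exact_mod_cast hab)
    exact add_lt_add_of_le_of_lt a1 a2
  rw [Metric.tendsto_atTop']
  intro ε hε
  -- With this `k` the load is at most `ε / 4` times `M + C`; the rest of `ε` absorbs `C` and `g`
  -- once `M` is large.
  obtain ⟨k, hk⟩ := exists_nat_gt (4 / ε)
  have hk0 : (0 : ℝ) < k := (by positivity : (0 : ℝ) < 4 / ε).trans hk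
  obtain ⟨C, hC⟩ := load_alternative k S hS
  have hD := abs_nonneg (C : ℝ)
  have hCD := le_abs_self (C : ℝ)
  set D : ℝ := |(C : ℝ)|
  obtain ⟨N, hN⟩ := eventually_atTop.1
    ((hMR.eventually_ge_atTop (D + (D + 4) / ε + 5)).and (eventually_ge_atTop 0))
  refine ⟨N, fun n hnN => ?_⟩
  obtain ⟨b1, b2⟩ := hN n hnN.le
  have hDε : 0 ≤ (D + 4) / ε := by positivity
  have b3 : ε * D + (D + 4) + 5 * ε ≤ ε * pastMax S n := by
    have := mul_le_mul_of_nonneg_left b1 hε.le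
    have e : ε * ((D + 4) / ε) = D + 4 := by field_simp
    nlinarith
  obtain ⟨g1, g2⟩ := abs_le.1 (hgb n)
  have hpos : 0 < (pastMax S n : ℝ) + g n := by linarith
  have hl0 : (0 : ℝ) ≤ load S n := by
    exact_mod_cast sub_nonneg.2 (le_pastMax h.2.1 (le_refl n))
  have hSl : (S n : ℝ) = pastMax S n - load S n := by unfold load; push_cast; ring
  have hl : (load S n : ℝ) + 2 < ε * (pastMax S n - 2) := by
    rcases hC n b2 with hc | hc
    · have hc' : (load S n : ℝ) ≤ C := by exact_mod_cast hc
      nlinarith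
    · have hc' : (k : ℝ) * load S n ≤ pastMax S n + C := by exact_mod_cast hc
      have hk4 : 4 ≤ ε * k := by
        rw [div_lt_iff₀ hε] at hk; linarith
      have a1 : 4 * (load S n : ℝ) ≤ ε * (pastMax S n + C) := by
        have := mul_le_mul_of_nonneg_left hc' hε.le
        nlinarith [mul_le_mul_of_nonneg_right hk4 hl0]
      nlinarith
  have hgε : ε * (pastMax S n - 2) ≤ ε * (pastMax S n + g n) :=
    mul_le_mul_of_nonneg_left (by linarith) hε.le
  rw [Real.dist_eq, div_sub_one hpos.ne', abs_div, abs_of_pos hpos, div_lt_iff₀ hpos, abs_lt]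
  constructor <;> linarith

end Deterministic

/-! ### Critical paths and reversal of sub-critical ones -/

section Classification

variable {S : ℤ → ℤ}

theorem SubCriticalMinus_of_reverse (h : reverse S ∈ SubCriticalPlus) : S ∈ SubCriticalMinus := by
  obtain ⟨h0, F, hF, hF', hlim⟩ := h
  refine ⟨reverse_reverse S ▸ reverse_mem_Paths h0, fun n => -F (-n), fun a b hab =>
    neg_lt_neg (hF (neg_lt_neg hab)), ?_, ?_⟩
  · exact tendsto_neg_atTop_atBot.comp (hF'.comp tendsto_neg_atBot_atTop)
  · refine (hlim.comp tendsto_neg_atBot_atTop).congr fun n => ?_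
    simp [reverse, neg_div, div_neg]

/-- Reversibility makes `S` return to both levels `M` and `I` infinitely often in both directions,
so they are the upper and lower limits at each end. -/
theorem mem_Critical (h : S ∈ SRev) (hM : ∀ m n, pastMax S m = pastMax S n)
    (hI : ∀ m n, futureMin S m = futureMin S n) : S ∈ Critical := by
  have hle : ∀ m, S m ≤ pastMax S 0 := fun m => hM m 0 ▸ le_pastMax h.2.1 le_rfl
  have hge : ∀ m, futureMin S 0 ≤ S m := fun m => hI m 0 ▸ futureMin_le h.2.2.1 le_rfl
  have hleE : ∀ m, ((S m : ℝ) : EReal) ≤ ((pastMax S 0 : ℝ) : EReal) := fun m => by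
    exact_mod_cast hle m
  have hgeE : ∀ m, ((futureMin S 0 : ℝ) : EReal) ≤ ((S m : ℝ) : EReal) := fun m => by
    exact_mod_cast hge m
  have hlt : futureMin S 0 < pastMax S 0 := by
    have s := Paths.step h.1 1
    have := hle 0; have := hle 1; have := hge 0; have := hge 1
    norm_num at s
    omega
  obtain ⟨K, hK⟩ := Int.eq_ofNat_of_zero_le (sub_nonneg.2 hlt.le)
  have hKE : ((pastMax S 0 : ℝ) : EReal) - ((futureMin S 0 : ℝ) : EReal) = ((K : ℝ) : EReal) := by
    rw [← EReal.coe_sub]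
    congr 1
    exact_mod_cast hK
  have hsup : (⨆ n, (extPastMax S n - extFutureMin S n)) = ((K : ℝ) : EReal) := by
    rw [← hKE]
    refine (iSup_congr fun n => ?_).trans iSup_const
    rw [← coe_pastMax (bddAbove_image_Iic h.2.1 n), ← coe_futureMin (bddBelow_image_Ici h.2.2.1 n),
      hM n 0, hI n 0]
  have hsup_eq : ∀ l : Filter ℤ, (∃ᶠ m in l, S m = pastMax S 0) →
      limsup (fun n => ((S n : ℝ) : EReal)) l = ((pastMax S 0 : ℝ) : EReal) := fun l hl => by
    apply le_antisymm
    · exact limsup_le_of_le (h := Eventually.of_forall hleE)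
    · exact le_limsup_of_frequently_le (hl.mono fun m e => by rw [e])
  have hinf_eq : ∀ l : Filter ℤ, (∃ᶠ m in l, S m = futureMin S 0) →
      liminf (fun n => ((S n : ℝ) : EReal)) l = ((futureMin S 0 : ℝ) : EReal) := fun l hl => by
    apply le_antisymm
    · exact liminf_le_of_frequently_le (hl.mono fun m e => by rw [e])
    · exact le_liminf_of_le (h := Eventually.of_forall hgeE)
  have f1 : ∃ᶠ m in atTop, S m = pastMax S 0 := frequently_atTop.2 fun n => by
    obtain ⟨m, hm, e⟩ := exists_future_eq_pastMax h n
    exact ⟨m, hm, e.trans (hM _ _)⟩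
  have f2 : ∃ᶠ m in atBot, S m = pastMax S 0 := frequently_atBot.2 fun n => by
    obtain ⟨m, hm, e⟩ := exists_eq_pastMax h.2.1 n
    exact ⟨m, hm, e.trans (hM _ _)⟩
  have f3 : ∃ᶠ m in atTop, S m = futureMin S 0 := frequently_atTop.2 fun n => by
    obtain ⟨m, hm, e⟩ := exists_eq_futureMin h.2.2.1 n
    exact ⟨m, hm, e.trans (hI _ _)⟩
  have f4 : ∃ᶠ m in atBot, S m = futureMin S 0 := frequently_atBot.2 fun n => by
    obtain ⟨m, hm, e⟩ := exists_past_eq_futureMin h n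
    exact ⟨m, hm, e.trans (hI _ _)⟩
  have hK0 : 0 < K := by omega
  refine ⟨⟨h.1, K, hK0, hsup, ?_⟩, ⟨h.1, K, hK0, hsup, ?_⟩⟩
  · rw [hsup_eq _ f2, hinf_eq _ f4, hKE]
  · rw [hsup_eq _ f1, hinf_eq _ f3, hKE]

theorem exists_const_pastMax_of_CriticalPlus (h : S ∈ SRev) (hc : S ∈ CriticalPlus) :
    ∃ n, ∀ m, n ≤ m → pastMax S m = pastMax S n := by
  by_contra! hn
  have hM := tendsto_pastMax h.2.1 (by simpa using hn)
  obtain ⟨-, K, -, -, hK⟩ := hc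
  have htop : limsup (fun n => ((S n : ℝ) : EReal)) atTop = ⊤ := by
    refine EReal.eq_top_iff_forall_lt _ |>.2 fun y => ?_
    obtain ⟨b, hb⟩ := exists_int_gt y
    refine lt_of_lt_of_le (EReal.coe_lt_coe_iff.2 hb)
      (le_limsup_of_frequently_le (frequently_atTop.2 fun n => ?_))
    obtain ⟨p, hnp, hp⟩ := ((hM.eventually_ge_atTop b).and (eventually_ge_atTop n)).exists
    obtain ⟨m, hm, e⟩ := exists_future_eq_pastMax h p
    exact ⟨m, by omega, by exact_mod_cast (by omega : b ≤ S m)⟩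
  rw [htop] at hK
  by_cases hl : liminf (fun n => ((S n : ℝ) : EReal)) atTop = ⊤
  -- In `EReal`, `⊤ - ⊤ = ⊥`, which is not a finite `K`.
  · rw [hl] at hK; exact EReal.coe_ne_bot _ hK.symm
  · rw [EReal.top_sub hl] at hK
    exact EReal.coe_ne_top _ hK.symm

end Classification

/-! ### Measurability of the dynamics and of `SRev` -/

section Measurability

theorem measurable_pastMax (n : ℤ) : Measurable fun S : ℤ → ℤ => pastMax S n := by
  unfold pastMax
  simp_rw [sSup_image']
  exact Measurable.iSup fun m => measurable_pi_apply _

theorem measurable_futureMin (n : ℤ) : Measurable fun S : ℤ → ℤ => futureMin S n := by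
  unfold futureMin
  simp_rw [sInf_image']
  exact Measurable.iInf fun m => measurable_pi_apply _

theorem measurable_T : Measurable T := measurable_pi_lambda _ fun n =>
  (((measurable_pastMax n).const_mul 2).sub (measurable_pi_apply n)).sub
    ((measurable_pastMax 0).const_mul 2)

theorem measurable_TInv : Measurable TInv := measurable_pi_lambda _ fun n =>
  (((measurable_futureMin n).const_mul 2).sub (measurable_pi_apply n)).sub
    ((measurable_futureMin 0).const_mul 2)

theorem measurable_reverse : Measurable reverse :=
  measurable_pi_lambda _ fun n => (measurable_pi_apply (-n)).neg

theorem measurable_load (n : ℤ) : Measurable fun S : ℤ → ℤ => load S n :=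
  (measurable_pastMax n).sub (measurable_pi_apply n)

theorem measurable_pathEncoding : Measurable pathEncoding := by
  have hm : ∀ m : ℤ, Measurable fun η : Config => (1 - 2 * ((η m : ℕ) : ℤ)) := fun m =>
    (measurable_of_finite fun x : Fin 2 => (1 - 2 * ((x : ℕ) : ℤ))).comp (measurable_pi_apply m)
  exact measurable_pi_lambda _ fun n =>
    (Finset.measurable_sum _ fun m _ => hm m).sub (Finset.measurable_sum _ fun m _ => hm m)

theorem measurableSet_Paths : MeasurableSet Paths := by
  have : Paths = {S | S 0 = 0} ∩ ⋂ n : ℤ, (fun S => S n - S (n - 1)) ⁻¹' {x : ℤ | |x| = 1} := by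
    ext S; simp [Paths]
  rw [this]
  exact (measurableSet_eq_fun (measurable_pi_apply 0) measurable_const).inter <|
    MeasurableSet.iInter fun n => ((measurable_pi_apply n).sub (measurable_pi_apply (n - 1)))
      (MeasurableSet.of_discrete)

theorem measurableSet_DomT : MeasurableSet DomT := by
  have : DomT = Paths ∩ ⋃ b : ℤ, ⋂ m : Iic (0 : ℤ), {S | S m ≤ b} := by
    ext S; simp [DomT, BddAbove, Set.Nonempty, upperBounds]
  exact this ▸ measurableSet_Paths.inter <| MeasurableSet.iUnion fun b => MeasurableSet.iInter fun m =>
    measurableSet_le (measurable_pi_apply _) measurable_const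

theorem measurableSet_DomTInv : MeasurableSet DomTInv := by
  have : DomTInv = Paths ∩ ⋃ b : ℤ, ⋂ m : Ici (0 : ℤ), {S | b ≤ S m} := by
    ext S; simp [DomTInv, BddBelow, Set.Nonempty, lowerBounds]
  exact this ▸ measurableSet_Paths.inter <| MeasurableSet.iUnion fun b => MeasurableSet.iInter fun m =>
    measurableSet_le measurable_const (measurable_pi_apply _)

theorem measurableSet_SRev : MeasurableSet SRev :=
  measurableSet_Paths.inter <| measurableSet_DomT.inter <| measurableSet_DomTInv.inter <|
    (measurable_T measurableSet_DomTInv).inter <| (measurable_TInv measurableSet_DomT).inter <|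
    (measurableSet_eq_fun (measurable_TInv.comp measurable_T) measurable_id).inter
      (measurableSet_eq_fun (measurable_T.comp measurable_TInv) measurable_id)

end Measurability

/-- A law of paths that is supported by `SRev` and invariant under the dynamics. -/
structure InvariantLaw (μ : Measure (ℤ → ℤ)) : Prop where
  rev : ∀ᵐ S ∂μ, S ∈ SRev
  preserving : MeasurePreserving T μ μ

/-! ### Almost sure consequences of invariance -/

namespace InvariantLaw

variable {μ : Measure (ℤ → ℤ)}

theorem preserving_TInv (h : InvariantLaw μ) : MeasurePreserving TInv μ μ := by
  refine ⟨measurable_TInv, ?_⟩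
  conv_lhs => rw [← h.preserving.map_eq]
  rw [Measure.map_map measurable_TInv measurable_T,
    Measure.map_congr (f := TInv ∘ T) (g := id) (h.rev.mono fun S hS => hS.2.2.2.2.2.1), Measure.map_id]

theorem reversed (h : InvariantLaw μ) : InvariantLaw (μ.map reverse) := by
  have hr : MeasurePreserving reverse μ (μ.map reverse) := measurable_reverse.measurePreserving μ
  have hr' : MeasurePreserving reverse (μ.map reverse) μ :=
    ⟨measurable_reverse, by
      rw [Measure.map_map measurable_reverse measurable_reverse,
        show reverse ∘ reverse = id from funext reverse_reverse, Measure.map_id]⟩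
  constructor
  · filter_upwards [hr'.quasiMeasurePreserving.ae h.rev] with S hS
    simpa using reverse_mem_SRev hS
  · have : T = reverse ∘ TInv ∘ reverse := funext fun S => by
      simp [← T_reverse]
    rw [this]
    exact hr.comp (h.preserving_TInv.comp hr')

theorem ae_iterate_TInv (h : InvariantLaw μ) : ∀ᵐ S ∂μ, ∀ j : ℕ, TInv^[j] S ∈ SRev :=
  ae_all_iff.2 fun j => (h.preserving_TInv.iterate j).quasiMeasurePreserving.ae h.rev

theorem ae_rev_T (h : InvariantLaw μ) : ∀ᵐ S ∂μ, T S ∈ SRev :=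
  h.preserving.quasiMeasurePreserving.ae h.rev

/-- An increasing family of events whose measures do not increase is almost surely constant. -/
theorem _root_.MeasureTheory.ae_forall_mem_of_monotone {α : Type*} [MeasurableSpace α]
    {μ : Measure α} [IsFiniteMeasure μ] {A : ℤ → Set α} (hA : ∀ n, MeasurableSet (A n))
    (hmono : ∀ n, A (n - 1) ⊆ A n) (hle : ∀ n, μ (A n) ≤ μ (A (n - 1))) :
    ∀ᵐ x ∂μ, ∀ n m, x ∈ A n → x ∈ A m := by
  have hstep : ∀ n, ∀ᵐ x ∂μ, x ∈ A n → x ∈ A (n - 1) := fun n => by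
    have h0 : μ (A n \ A (n - 1)) = 0 := by
      rw [measure_sdiff (hmono n) (hA _).nullMeasurableSet (measure_ne_top _ _),
        tsub_eq_zero_of_le (hle n)]
    filter_upwards [measure_eq_zero_iff_ae_notMem.1 h0] with x hx hxn
    by_contra hx'
    exact hx ⟨hxn, hx'⟩
  filter_upwards [ae_all_iff.2 hstep] with x hx n m hn
  rcases le_total n m with hnm | hnm
  · induction m, hnm using Int.leInduction with
    | base => exact hn
    | succ m _ ih => exact hmono (m + 1) (by simpa using ih)
  · induction m, hnm using Int.leInductionDown with
    | base => exact hn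
    | pred m _ ih => exact hx m ih

variable [IsProbabilityMeasure μ]

theorem ae_load_le (h : InvariantLaw μ) : ∀ᵐ S ∂μ, ∀ k : ℤ, 0 ≤ k →
    ∀ p, (∀ m, p < m → load S m ≤ k) → ∀ m, load S m ≤ k := by
  refine ae_all_iff.2 fun k => ae_all_iff.2 fun hk => ?_
  let A : ℤ → Set (ℤ → ℤ) := fun n => {S | ∀ m, n < m → load S m ≤ k}
  have hA : ∀ n, MeasurableSet (A n) := fun n => by
    simp only [A, ofPred_forall]
    exact MeasurableSet.iInter fun m => MeasurableSet.iInter fun _ =>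
      measurableSet_le (measurable_load m) measurable_const
  have hae := ae_forall_mem_of_monotone (μ := μ) hA
    (fun n S hS m hm => hS m (by omega)) fun n => by
      -- The strict shift of loads to the right gives `T⁻¹' A n ⊆ A (n - 1)` a.s., gaining one site.
      rw [← h.preserving.measure_preimage (hA n).nullMeasurableSet]
      refine measure_mono_ae ?_
      filter_upwards [h.rev, h.ae_rev_T] with S hS hTS hmem m hm
      by_contra! hlt
      obtain ⟨q, hq, hq'⟩ := exists_lt_load_T hS hTS m k hk hlt
      exact hq'.not_ge (hmem q (by omega))
  filter_upwards [hae] with S hS p hp m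
  exact hS p (m - 1) hp m (by omega)

theorem ae_const_of_eventually_const (h : InvariantLaw μ) : ∀ᵐ S ∂μ,
    ∀ n, (∀ m, n ≤ m → pastMax S m = pastMax S n) →
      (∀ m m', pastMax S m = pastMax S m') ∧ ∀ m m', futureMin S m = futureMin S m' := by
  let C : ℤ → Set (ℤ → ℤ) := fun n => {S | ∀ m, n ≤ m → futureMin S m = futureMin S n}
  let D : ℤ → Set (ℤ → ℤ) := fun n => {S | ∀ m, n ≤ m → pastMax S m = pastMax S n}
  have hC : ∀ n, MeasurableSet (C n) := fun n => by
    simp only [C, ofPred_forall]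
    exact MeasurableSet.iInter fun m => MeasurableSet.iInter fun _ =>
      measurableSet_eq_fun (measurable_futureMin m) (measurable_futureMin n)
  have hD : ∀ n, MeasurableSet (D n) := fun n => by
    simp only [D, ofPred_forall]
    exact MeasurableSet.iInter fun m => MeasurableSet.iInter fun _ =>
      measurableSet_eq_fun (measurable_pastMax m) (measurable_pastMax n)
  -- By `futureMin_T`, the preimage of `C n` under `T` is `D n` almost surely. Together with `D n ⊆
  -- C (n - 1)` a.s., neither family can gain measure as `n` grows.
  have hCD : ∀ n, μ (C n) = μ (D n) := fun n => by
    rw [← h.preserving.measure_preimage (hC n).nullMeasurableSet]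
    refine measure_congr ?_
    filter_upwards [h.rev] with S hS
    refine propext (forall₂_congr fun m _ => ?_)
    rw [futureMin_T hS, futureMin_T hS, sub_left_inj]
  have hsub : ∀ n, ∀ᵐ S ∂μ, S ∈ D n → S ∈ C (n - 1) := fun n => by
    filter_upwards [h.rev, h.ae_load_le] with S hS hW hn
    exact eventually_const_futureMin hS hn hW
  have hle : ∀ n, μ (D n) ≤ μ (C (n - 1)) := fun n => measure_mono_ae (hsub n)
  have hDae := ae_forall_mem_of_monotone (μ := μ) hD
    (fun n S hS m hm => (hS m (by omega)).trans (hS n (by omega)).symm)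
    fun n => (hle n).trans (hCD _).le
  have hCae := ae_forall_mem_of_monotone (μ := μ) hC
    (fun n S hS m hm => (hS m (by omega)).trans (hS n (by omega)).symm)
    fun n => (hCD n).le.trans (hle n)
  filter_upwards [hDae, hCae, ae_all_iff.2 hsub] with S h1 h2 h3 n hn
  have hconst : ∀ f : ℤ → ℤ, (∀ n m, n ≤ m → f m = f n) → ∀ m m', f m = f m' := fun f hf m m' =>
    (hf _ _ (min_le_left m m')).trans (hf _ _ (min_le_right m m')).symm
  exact ⟨hconst _ fun p => h1 n p hn, hconst _ fun p => h2 _ p (h3 n hn)⟩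

theorem ae_mem_SubCritical_union_Critical (h : InvariantLaw μ) :
    ∀ᵐ S ∂μ, S ∈ SubCritical ∪ Critical := by
  have hr : MeasurePreserving reverse μ (μ.map reverse) := measurable_reverse.measurePreserving μ
  have : IsProbabilityMeasure (μ.map reverse) :=
    Measure.isProbabilityMeasure_map measurable_reverse.aemeasurable
  have e1 := hr.quasiMeasurePreserving.ae h.reversed.ae_iterate_TInv
  have e2 := hr.quasiMeasurePreserving.ae h.reversed.ae_const_of_eventually_const
  filter_upwards [h.rev, h.ae_iterate_TInv, h.ae_const_of_eventually_const, e1, e2]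
    with S hS hit hc hit' hc'
  by_cases H : ∃ n, ∀ m, n ≤ m → pastMax S m = pastMax S n
  · obtain ⟨n, hn⟩ := H
    exact Or.inr (mem_Critical hS (hc n hn).1 (hc n hn).2)
  by_cases H' : ∃ n, ∀ m, n ≤ m → pastMax (reverse S) m = pastMax (reverse S) n
  · obtain ⟨n, hn⟩ := H'
    obtain ⟨a, b⟩ := hc' n hn
    refine Or.inr (mem_Critical hS (fun m m' => ?_) fun m m' => ?_)
    · have := b (-m) (-m')
      simp only [futureMin_reverse, neg_neg] at this
      omega
    · have := a (-m) (-m')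
      simp only [pastMax_reverse, neg_neg] at this
      omega
  · push Not at H H'
    exact Or.inl ⟨SubCriticalMinus_of_reverse (mem_SubCriticalPlus hit' (by simpa using H')),
      mem_SubCriticalPlus hit (by simpa using H)⟩

end InvariantLaw

/-- Paths with a particle at `n`, i.e. stepping down there. -/
def downAt (n : ℤ) : Set (ℤ → ℤ) := {S | S n = S (n - 1) - 1}

theorem measurableSet_downAt (n : ℤ) : MeasurableSet (downAt n) :=
  measurableSet_eq_fun (measurable_pi_apply n) ((measurable_pi_apply (n - 1)).sub measurable_const)

/-! ### Particle density -/

theorem T_mem_downAt_iff {S : ℤ → ℤ} (h : S ∈ DomT) (n : ℤ) :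
    T S ∈ downAt n ↔ S ∉ downAt n ∧ pastMax S n = pastMax S (n - 1) := by
  have s := Paths.step h.1 n
  have a1 := pastMax_eq_max h n
  have a2 := le_pastMax h (le_refl (n - 1))
  simp only [downAt, mem_ofPred_eq, T]
  omega

theorem T_downAt_exchange {S : ℤ → ℤ} (h : S ∈ DomT) (n : ℤ) :
    (T S ∈ downAt (n + 1) ∧ T S ∉ downAt n) ↔ (S ∈ downAt n ∧ S ∉ downAt (n + 1)) := by
  rw [T_mem_downAt_iff h, T_mem_downAt_iff h]
  have s := Paths.step h.1 n
  have s' := Paths.step h.1 (n + 1)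
  have a1 := pastMax_eq_max h n
  have a2 := pastMax_eq_max h (n + 1)
  have a3 := le_pastMax h (le_refl (n - 1))
  simp only [downAt, mem_ofPred_eq, add_sub_cancel_right] at *
  omega

namespace InvariantLaw

variable {μ : Measure (ℤ → ℤ)} [IsProbabilityMeasure μ]

/-- `T` turns the pattern particle-hole at `n, n + 1` into hole-particle. Invariance makes these
patterns equally likely, so neighbouring densities agree without assuming stationarity in space. -/
theorem measureReal_downAt (h : InvariantLaw μ) (n : ℤ) :
    μ.real (downAt n) = μ.real (downAt 0) := by
  have hstep : ∀ n, μ.real (downAt (n + 1)) = μ.real (downAt n) := fun n => by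
    have e : μ.real (downAt (n + 1) \ downAt n) = μ.real (downAt n \ downAt (n + 1)) := by
      rw [← h.preserving.measureReal_preimage
        ((measurableSet_downAt _).diff (measurableSet_downAt _)).nullMeasurableSet]
      refine measureReal_congr ?_
      filter_upwards [h.rev] with S hS
      exact propext (T_downAt_exchange hS.2.1 n)
    have e1 := measureReal_inter_add_sdiff (μ := μ) (s := downAt (n + 1)) (measurableSet_downAt n)
    have e2 := measureReal_inter_add_sdiff (μ := μ) (s := downAt n) (measurableSet_downAt (n + 1))
    rw [inter_comm] at e2
    linarith
  induction n using Int.induction_on with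
  | zero => rfl
  | succ n ih => rw [hstep, ih]
  | pred n ih => rw [← ih, ← hstep (-n - 1), sub_add_cancel]

theorem measureReal_record (h : InvariantLaw μ) (n : ℤ) :
    μ.real {S | pastMax S n ≠ pastMax S (n - 1)} = 1 - 2 * μ.real (downAt 0) := by
  have hd := measurableSet_downAt n
  have hTd : MeasurableSet (T ⁻¹' downAt n) := measurable_T hd
  have e1 := measureReal_inter_add_sdiff (μ := μ) (s := (downAt n)ᶜ) hTd
  have e2 : μ.real ((downAt n)ᶜ ∩ T ⁻¹' downAt n) = μ.real (downAt 0) := by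
    rw [← h.measureReal_downAt n,
      ← h.preserving.measureReal_preimage (s := downAt n) hd.nullMeasurableSet]
    refine measureReal_congr ?_
    filter_upwards [h.rev] with S hS
    exact propext ⟨fun hx => hx.2, fun hx => ⟨((T_mem_downAt_iff hS.2.1 n).1 hx).1, hx⟩⟩
  have e3 : μ.real ((downAt n)ᶜ \ T ⁻¹' downAt n) =
      μ.real {S | pastMax S n ≠ pastMax S (n - 1)} := by
    refine measureReal_congr ?_
    filter_upwards [h.rev] with S hS
    refine propext ⟨fun hx hM => hx.2 ((T_mem_downAt_iff hS.2.1 n).2 ⟨hx.1, hM⟩), fun hx => ?_⟩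
    refine ⟨fun hdn => hx ?_, fun hT => hx ((T_mem_downAt_iff hS.2.1 n).1 hT).2⟩
    have a1 := pastMax_eq_max hS.2.1 n
    have a2 := le_pastMax hS.2.1 (le_refl (n - 1))
    change S n = S (n - 1) - 1 at hdn
    omega
  have e4 := probReal_compl_eq_one_sub (μ := μ) hd
  rw [h.measureReal_downAt n] at e4
  linarith

theorem measureReal_downAt_eq_half_iff (h : InvariantLaw μ) (n : ℤ) :
    μ.real (downAt 0) = 1 / 2 ↔ ∀ᵐ S ∂μ, pastMax S n = pastMax S (n - 1) := by
  have e : (∀ᵐ S ∂μ, pastMax S n = pastMax S (n - 1)) ↔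
      μ.real {S | pastMax S n ≠ pastMax S (n - 1)} = 0 := by
    rw [measureReal_eq_zero_iff]; exact ae_iff
  rw [e, h.measureReal_record n]
  constructor <;> intro h <;> linarith

theorem ae_mem_Critical (h : InvariantLaw μ) (hρ : μ.real (downAt 0) = 1 / 2) :
    ∀ᵐ S ∂μ, S ∈ Critical := by
  filter_upwards [h.rev, h.ae_const_of_eventually_const,
    ae_all_iff.2 fun n => (h.measureReal_downAt_eq_half_iff n).1 hρ] with S hS hc hM
  have hcon := hc 0 fun m hm => by
    induction m, hm using Int.leInduction with
    | base => rfl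
    | succ m _ ih => rw [hM (m + 1), add_sub_cancel_right, ih]
  exact mem_Critical hS hcon.1 hcon.2

end InvariantLaw

/-! ### From configurations to path laws -/

theorem pathEncoding_mem_downAt_iff (η : Config) (n : ℤ) :
    pathEncoding η ∈ downAt n ↔ η n = 1 := by
  have h := pathEncoding_step η n
  have hv : (η n : ℕ) < 2 := (η n).isLt
  rw [Fin.ext_iff]
  simp only [downAt, mem_ofPred_eq, Fin.val_one]
  omega

theorem eq_pathEncoding {S : ℤ → ℤ} {η : Config} (h : S ∈ Paths)
    (hη : ∀ n, η n = 1 ↔ S ∈ downAt n) : pathEncoding η = S := by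
  have hstep : ∀ n, pathEncoding η n - pathEncoding η (n - 1) = S n - S (n - 1) := fun n => by
    have s := Paths.step h n
    have e := (hη n).symm
    rw [Fin.ext_iff] at e
    have p := pathEncoding_step η n
    have hv : (η n : ℕ) < 2 := (η n).isLt
    simp only [downAt, mem_ofPred_eq, Fin.val_one] at e
    omega
  funext n
  induction n using Int.induction_on with
  | zero => rw [pathEncoding_zero, h.1]
  | succ n ih => have := hstep (n + 1); rw [add_sub_cancel_right] at this; omega
  | pred n ih => have := hstep (-n); omega

theorem pathEncoding_configT {η : Config} (h : pathEncoding η ∈ SRev) :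
    pathEncoding (configT η) = T (pathEncoding η) := by
  refine eq_pathEncoding h.2.2.2.1.1 fun n => ?_
  simp [configT, downAt]

theorem invariantLaw_map_pathEncoding {Ω : Type*} [MeasurableSpace Ω] {P : Measure Ω}
    {η : Ω → Config} (hη : Measurable η) (hrev : ∀ᵐ ω ∂P, pathEncoding (η ω) ∈ SRev)
    (hinv : ProbabilityTheory.IdentDistrib (fun ω => configT (η ω)) η P P) :
    InvariantLaw (P.map (pathEncoding ∘ η)) := by
  have hX : Measurable (pathEncoding ∘ η) := measurable_pathEncoding.comp hη
  refine ⟨(ae_map_iff hX.aemeasurable measurableSet_SRev).2 hrev, measurable_T, ?_⟩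
  rw [Measure.map_map measurable_T hX, ← (hinv.comp measurable_pathEncoding).map_eq]
  exact Measure.map_congr (hrev.mono fun ω hω => (pathEncoding_configT hω).symm)

end BoxBall

theorem theorem1p2 {Ω : Type*} [MeasurableSpace Ω] (P : MeasureTheory.Measure Ω)
    [MeasureTheory.IsProbabilityMeasure P] (η : Ω → BoxBall.Config) (hη : Measurable η)
    (hrev : ∀ᵐ ω ∂P, BoxBall.pathEncoding (η ω) ∈ BoxBall.SRev)
    (hinv : ProbabilityTheory.IdentDistrib (fun ω => BoxBall.configT (η ω)) η P P) :
    (∀ᵐ ω ∂P, BoxBall.pathEncoding (η ω) ∈ BoxBall.SubCritical ∪ BoxBall.Critical) ∧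
    ∃ ρ : ℝ, 0 ≤ ρ ∧ ρ ≤ 1 / 2 ∧ (∀ n : ℤ, P.real {ω | η ω n = 1} = ρ) ∧
      (ρ = 1 / 2 ↔ ∀ᵐ ω ∂P, BoxBall.pathEncoding (η ω) ∈ BoxBall.Critical) := by
  have hX : Measurable (BoxBall.pathEncoding ∘ η) := BoxBall.measurable_pathEncoding.comp hη
  have := MeasureTheory.Measure.isProbabilityMeasure_map (μ := P) hX.aemeasurable
  have h := BoxBall.invariantLaw_map_pathEncoding hη hrev hinv
  refine ⟨MeasureTheory.ae_of_ae_map hX.aemeasurable h.ae_mem_SubCritical_union_Critical,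
    _, MeasureTheory.measureReal_nonneg, ?_, fun n => ?_,
    fun hρ => MeasureTheory.ae_of_ae_map hX.aemeasurable (h.ae_mem_Critical hρ), fun hcrit => ?_⟩
  · have e := h.measureReal_record 0
    have : (0 : ℝ) ≤ _ := e ▸ MeasureTheory.measureReal_nonneg
    linarith
  · rw [← h.measureReal_downAt n,
      MeasureTheory.map_measureReal_apply hX (BoxBall.measurableSet_downAt n)]
    congr 1
    ext ω
    exact (BoxBall.pathEncoding_mem_downAt_iff (η ω) n).symm
  · refine (h.measureReal_downAt_eq_half_iff 0).2 ?_
    refine (MeasureTheory.ae_map_iff hX.aemeasurable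
      (measurableSet_eq_fun (BoxBall.measurable_pastMax _) (BoxBall.measurable_pastMax _))).2 ?_
    filter_upwards [hrev, MeasureTheory.ae_of_ae_map hX.aemeasurable
      h.ae_const_of_eventually_const, hcrit] with ω hS hc hcr
    -- Criticality at `+∞` makes `M` eventually constant; the dichotomy then makes it constant
    -- everywhere, so there is no record at `0`.
    obtain ⟨n, hn⟩ := BoxBall.exists_const_pastMax_of_CriticalPlus hS hcr.2
    exact (hc n hn).1 _ _
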